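/- Let $\mathcal{M}$ be a smooth finite-dimensional Riemannian manifold (possibly with boundary) with Levi-Civita connection $\nabla$, and let $f:\mathcal{M}\to\mathbb{R}$ be a smooth function. Let $\mathrm{Hess}_f := \nabla\nabla f$ be its Hessian tensor, that is, $\mathrm{Hess}_f(X,Y) = X(Yf) - (\nabla_X Y)f$ for vector fields $X,Y$. A geodesic is a $C^2$ (equivalently, smooth) curve $\gamma: J\to\mathcal{M}$ on an interval $J\subseteq\mathbb{R}$ whose velocity satisfies $\frac{D\dot\gamma}{dt}=0$ on $J$, where $\frac{D}{dt}$ is the covariant derivative along $\gamma$ induced by $\nabla$. Then $\mathrm{Hess}_f = 0$ on $\mathcal{M}$ if and only if for every interval $J$ and every geodesic $\gamma: J\to\mathcal{M}$ the function $t\mapsto f(\gamma(t))$ is affine on $J$, i.e. there are $a,b\in\mathbb{R}$ with $f(\gamma(t)) = at+b$ for all $t\in J$. -/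

import Mathlib

open Bundle FiberBundle VectorField
open scoped Manifold ContDiff Bundle

noncomputable section

namespace RiemannianHessian

set_option linter.unusedSectionVars false

section LeviCivita

variable {E : Type*} [NormedAddCommGroup E] [NormedSpace ℝ E] [FiniteDimensional ℝ E]
  {H : Type*} [TopologicalSpace H] {I : ModelWithCorners ℝ E H}
  {M : Type*} [TopologicalSpace M] [ChartedSpace H M] [IsManifold I ∞ M]
  [RiemannianBundle (fun x : M ↦ TangentSpace I x)]
  [IsContMDiffRiemannianBundle I ∞ E (fun x : M ↦ TangentSpace I x)]

/-- The Koszul expression for `⟨∇_X Y, Z⟩` at `x`: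
`½ (X⟨Y,Z⟩ + Y⟨X,Z⟩ - Z⟨X,Y⟩ + ⟨[X,Y],Z⟩ - ⟨[X,Z],Y⟩ - ⟨[Y,Z],X⟩)`. -/
def koszul (X Y Z : Π x : M, TangentSpace I x) (x : M) : ℝ :=
  (1 / 2 : ℝ) *
    (d% (fun y ↦ inner ℝ (Y y) (Z y)) x (X x) + d% (fun y ↦ inner ℝ (X y) (Z y)) x (Y x)
      - d% (fun y ↦ inner ℝ (X y) (Y y)) x (Z x)
      + inner ℝ (mlieBracket I X Y x) (Z x) - inner ℝ (mlieBracket I X Z x) (Y x)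
      - inner ℝ (mlieBracket I Y Z x) (X x))

variable {x : M}

theorem mdifferentiableAt_inner {Y Z : Π x : M, TangentSpace I x}
    (hY : MDiffAt (T% Y) x) (hZ : MDiffAt (T% Z) x) :
    MDiffAt (fun y ↦ inner ℝ (Y y) (Z y)) x :=
  MDifferentiableAt.inner_bundle (IB := I) (F := E) (E := fun x : M ↦ TangentSpace I x)
    (b := fun y ↦ y) (v := Y) (w := Z) hY hZ

theorem koszul_tensorial_left {Y Z : Π x : M, TangentSpace I x}
    (hY : MDiffAt (T% Y) x) (hZ : MDiffAt (T% Z) x) :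
    TensorialAt I E (fun X ↦ koszul X Y Z x) x where
  smul {f X} hf hX := by
    have h1 : (fun y ↦ inner ℝ ((f • X) y) (Z y)) = fun y ↦ f y * inner ℝ (X y) (Z y) := by
      ext y; simp [inner_smul_left]
    have h2 : (fun y ↦ inner ℝ ((f • X) y) (Y y)) = fun y ↦ f y * inner ℝ (X y) (Y y) := by
      ext y; simp [inner_smul_left]
    simp only [koszul, h1, h2]
    rw [mvfderiv_fun_mul hf (mdifferentiableAt_inner hX hZ),
      mvfderiv_fun_mul hf (mdifferentiableAt_inner hX hY),
      mlieBracket_smul_left hf hX, mlieBracket_smul_left hf hX]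
    simp [inner_add_left, inner_smul_left, inner_smul_right, real_inner_comm]
    ring
  add {X X'} hX hX' := by
    have h1 : (fun y ↦ inner ℝ ((X + X') y) (Z y)) =
        fun y ↦ inner ℝ (X y) (Z y) + inner ℝ (X' y) (Z y) := by
      ext y; simp [inner_add_left]
    have h2 : (fun y ↦ inner ℝ ((X + X') y) (Y y)) =
        fun y ↦ inner ℝ (X y) (Y y) + inner ℝ (X' y) (Y y) := by
      ext y; simp [inner_add_left]
    simp only [koszul, h1, h2]
    rw [mvfderiv_fun_add (mdifferentiableAt_inner hX hZ) (mdifferentiableAt_inner hX' hZ),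
      mvfderiv_fun_add (mdifferentiableAt_inner hX hY) (mdifferentiableAt_inner hX' hY),
      mlieBracket_add_left hX hX', mlieBracket_add_left hX hX']
    simp [inner_add_left, inner_add_right]
    ring

theorem koszul_tensorial_right {X Y : Π x : M, TangentSpace I x}
    (hX : MDiffAt (T% X) x) (hY : MDiffAt (T% Y) x) :
    TensorialAt I E (fun Z ↦ koszul X Y Z x) x where
  smul {f Z} hf hZ := by
    have h1 : (fun y ↦ inner ℝ (Y y) ((f • Z) y)) = fun y ↦ f y * inner ℝ (Y y) (Z y) := by
      ext y; simp [inner_smul_right]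
    have h2 : (fun y ↦ inner ℝ (X y) ((f • Z) y)) = fun y ↦ f y * inner ℝ (X y) (Z y) := by
      ext y; simp [inner_smul_right]
    simp only [koszul, h1, h2]
    rw [mvfderiv_fun_mul hf (mdifferentiableAt_inner hY hZ),
      mvfderiv_fun_mul hf (mdifferentiableAt_inner hX hZ),
      mlieBracket_smul_right hf hZ, mlieBracket_smul_right hf hZ]
    simp [inner_add_left, inner_smul_left, inner_smul_right, real_inner_comm]
    ring
  add {Z Z'} hZ hZ' := by
    have h1 : (fun y ↦ inner ℝ (Y y) ((Z + Z') y)) =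
        fun y ↦ inner ℝ (Y y) (Z y) + inner ℝ (Y y) (Z' y) := by
      ext y; simp [inner_add_right]
    have h2 : (fun y ↦ inner ℝ (X y) ((Z + Z') y)) =
        fun y ↦ inner ℝ (X y) (Z y) + inner ℝ (X y) (Z' y) := by
      ext y; simp [inner_add_right]
    simp only [koszul, h1, h2]
    rw [mvfderiv_fun_add (mdifferentiableAt_inner hY hZ) (mdifferentiableAt_inner hY hZ'),
      mvfderiv_fun_add (mdifferentiableAt_inner hX hZ) (mdifferentiableAt_inner hX hZ'),
      mlieBracket_add_right hZ hZ', mlieBracket_add_right hZ hZ']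
    simp [inner_add_left, inner_add_right]
    ring

theorem koszul_smul_middle {X Y Z : Π x : M, TangentSpace I x} {f : M → ℝ} (hf : MDiffAt f x)
    (hX : MDiffAt (T% X) x) (hY : MDiffAt (T% Y) x) (hZ : MDiffAt (T% Z) x) :
    koszul X (f • Y) Z x = f x * koszul X Y Z x + d% f x (X x) * inner ℝ (Y x) (Z x) := by
  have h1 : (fun y ↦ inner ℝ ((f • Y) y) (Z y)) = fun y ↦ f y * inner ℝ (Y y) (Z y) := by
    ext y; simp [inner_smul_left]
  have h2 : (fun y ↦ inner ℝ (X y) ((f • Y) y)) = fun y ↦ f y * inner ℝ (X y) (Y y) := by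
    ext y; simp [inner_smul_right]
  simp only [koszul, h1, h2]
  rw [mvfderiv_fun_mul hf (mdifferentiableAt_inner hY hZ),
    mvfderiv_fun_mul hf (mdifferentiableAt_inner hX hY),
    mlieBracket_smul_right hf hY, mlieBracket_smul_left hf hY]
  simp [inner_add_left, inner_smul_left, inner_smul_right, real_inner_comm]
  ring

theorem koszul_add_middle {X Y Y' Z : Π x : M, TangentSpace I x} (hX : MDiffAt (T% X) x)
    (hY : MDiffAt (T% Y) x) (hY' : MDiffAt (T% Y') x) (hZ : MDiffAt (T% Z) x) :
    koszul X (Y + Y') Z x = koszul X Y Z x + koszul X Y' Z x := by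
  have h1 : (fun y ↦ inner ℝ ((Y + Y') y) (Z y)) =
      fun y ↦ inner ℝ (Y y) (Z y) + inner ℝ (Y' y) (Z y) := by
    ext y; simp [inner_add_left]
  have h2 : (fun y ↦ inner ℝ (X y) ((Y + Y') y)) =
      fun y ↦ inner ℝ (X y) (Y y) + inner ℝ (X y) (Y' y) := by
    ext y; simp [inner_add_right]
  simp only [koszul, h1, h2]
  rw [mvfderiv_fun_add (mdifferentiableAt_inner hY hZ) (mdifferentiableAt_inner hY' hZ),
    mvfderiv_fun_add (mdifferentiableAt_inner hX hY) (mdifferentiableAt_inner hX hY'),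
    mlieBracket_add_left hY hY', mlieBracket_add_right hY hY']
  simp [inner_add_left, inner_add_right]
  ring

/-- The bilinear form `(X, Z) ↦ ⟨∇_X Y, Z⟩` at `x`, for a vector field `Y` differentiable at `x`. -/
def koszulForm (Y : Π x : M, TangentSpace I x) (x : M) (hY : MDiffAt (T% Y) x) :
    TangentSpace I x →L[ℝ] TangentSpace I x →L[ℝ] ℝ :=
  TensorialAt.mkHom₂ (I := I) (F := E) (F' := E) (fun X Z ↦ koszul X Y Z x) x
    (fun _ hZ ↦ koszul_tensorial_left hY hZ) (fun _ hX ↦ koszul_tensorial_right hX hY)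

theorem exists_riesz (K : TangentSpace I x →L[ℝ] TangentSpace I x →L[ℝ] ℝ) :
    ∃ A : TangentSpace I x →L[ℝ] TangentSpace I x, ∀ v w, inner ℝ (A v) w = K v w := by
  have : FiniteDimensional ℝ (TangentSpace I x) := inferInstanceAs (FiniteDimensional ℝ E)
  have : CompleteSpace (TangentSpace I x) := FiniteDimensional.complete ℝ _
  let A : TangentSpace I x →ₗ[ℝ] TangentSpace I x :=
    { toFun := fun v ↦ (InnerProductSpace.toDual ℝ (TangentSpace I x)).symm (K v)
      map_add' := fun v w ↦ by simp
      map_smul' := fun c v ↦ by simp }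
  exact ⟨LinearMap.toContinuousLinearMap A, fun v w ↦ by
    simp [A, InnerProductSpace.toDual_symm_apply]⟩

open Classical in
/-- `∇ Y` at `x`, determined by the Koszul formula (and `0` where `Y` is not differentiable). -/
def leviCivitaFun (Y : Π x : M, TangentSpace I x) (x : M) :
    TangentSpace I x →L[ℝ] TangentSpace I x :=
  if hY : MDiffAt (T% Y) x then (exists_riesz (koszulForm Y x hY)).choose else 0

theorem inner_leviCivitaFun {X Y Z : Π x : M, TangentSpace I x} (hX : MDiffAt (T% X) x)
    (hY : MDiffAt (T% Y) x) (hZ : MDiffAt (T% Z) x) :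
    inner ℝ (leviCivitaFun Y x (X x)) (Z x) = koszul X Y Z x := by
  rw [leviCivitaFun, dif_pos hY, (exists_riesz (koszulForm Y x hY)).choose_spec]
  exact TensorialAt.mkHom₂_apply _ _ hX hZ

theorem leviCivita_ext {A B : TangentSpace I x →L[ℝ] TangentSpace I x}
    (h : ∀ X Z : Π x : M, TangentSpace I x, MDiffAt (T% X) x → MDiffAt (T% Z) x →
      inner ℝ (A (X x)) (Z x) = inner ℝ (B (X x)) (Z x)) : A = B := by
  ext1 v
  refine ext_inner_right ℝ fun w ↦ ?_
  have := h (extend E v) (extend E w) (mdifferentiableAt_extend ..) (mdifferentiableAt_extend ..)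
  simpa using this

variable (I M) in
/-- The Levi-Civita connection of the Riemannian metric, in Mathlib's argument order:
`leviCivita I M Y x v` is `∇_v Y` at `x`. -/
def leviCivita : CovariantDerivative I E (TangentSpace I : M → Type _) where
  toFun := leviCivitaFun
  isCovariantDerivativeOnUniv :=
    { add := fun {Y Y' x} hY hY' _ ↦ leviCivita_ext fun X Z hX hZ ↦ by
        rw [inner_leviCivitaFun hX (mdifferentiableAt_add_section hY hY') hZ,
          koszul_add_middle hX hY hY' hZ, _root_.add_apply, inner_add_left,
          inner_leviCivitaFun hX hY hZ, inner_leviCivitaFun hX hY' hZ]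
      leibniz := fun {Y f x} hY hf _ ↦ leviCivita_ext fun X Z hX hZ ↦ by
        rw [inner_leviCivitaFun hX (hf.smul_section hY) hZ,
          koszul_smul_middle hf hX hY hZ]
        simp [inner_add_left, inner_smul_left, inner_leviCivitaFun hX hY hZ] }

/-- The Levi-Civita connection is torsion-free. -/
theorem leviCivita_torsion : (leviCivita I M).torsion = 0 := by
  rw [CovariantDerivative.torsion_eq_zero_iff]
  intro X Y x hX hY
  refine ext_inner_right ℝ fun w ↦ ?_
  have hZ : MDiffAt (T% (extend E w)) x := mdifferentiableAt_extend ..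
  have h1 := inner_leviCivitaFun hX hY hZ
  have h2 := inner_leviCivitaFun hY hX hZ
  simp only [extend_apply_self] at h1 h2
  rw [inner_sub_left]
  change inner ℝ (leviCivitaFun Y x (X x)) w - inner ℝ (leviCivitaFun X x (Y x)) w = _
  rw [h1, h2]
  simp only [koszul, extend_apply_self]
  rw [mlieBracket_swap_apply (V := Y) (W := X)]
  simp only [real_inner_comm, inner_neg_left]
  ring_nf

/-- The Levi-Civita connection is compatible with the metric. -/
theorem leviCivita_metric :
    CovariantDerivative.IsMetricCompatible (V := fun x : M ↦ TangentSpace I x)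
      (leviCivita I M) := by
  rw [CovariantDerivative.isMetricCompatible_iff]
  intro x X Y Z hX hY hZ
  have h1 := inner_leviCivitaFun hX hY hZ
  have h2 := inner_leviCivitaFun hX hZ hY
  change _ = inner ℝ (leviCivitaFun Y x (X x)) (Z x) + inner ℝ (Y x) (leviCivitaFun Z x (X x))
  rw [real_inner_comm _ (Y x), h1, h2]
  simp only [koszul]
  rw [mlieBracket_swap_apply (V := Z) (W := Y)]
  simp only [real_inner_comm, inner_neg_left]
  ring_nf

end LeviCivita

section Hessian

variable {E : Type*} [NormedAddCommGroup E] [NormedSpace ℝ E] [FiniteDimensional ℝ E]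
  {H : Type*} [TopologicalSpace H] {I : ModelWithCorners ℝ E H}
  {M : Type*} [TopologicalSpace M] [ChartedSpace H M] [IsManifold I ∞ M]

theorem mdifferentiableAt_mvfderiv_apply (f : C^∞⟮I, M; 𝓘(ℝ, ℝ), ℝ⟯) {x : M}
    {Y : Π x : M, TangentSpace I x} (hY : MDiffAt (T% Y) x) :
    MDiffAt (fun y ↦ d% f y (Y y)) x := by
  have h1 : MDifferentiableAt I.tangent 𝓘(ℝ, ℝ).tangent (tangentMap I 𝓘(ℝ, ℝ) f) ⟨x, Y x⟩ :=
    (f.contMDiff.contMDiff_tangentMap (m := 1) (by decide)).mdifferentiableAt (by simp)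
  have h2 := ((mdifferentiableAt_totalSpace _ _).1 (MDifferentiableAt.comp x h1 hY)).2
  have h3 : MDifferentiableAt (M' := ℝ) I 𝓘(ℝ, ℝ)
      (fun y ↦ mfderiv I 𝓘(ℝ, ℝ) f y (Y y)) x := by
    simpa [tangentMap, Function.comp_def] using h2
  exact h3

/-- `Y ↦ (X ↦ X (Y f) - (∇_X Y) f)` is tensorial in `Y`. -/
theorem hessian_tensorial (cov : CovariantDerivative I E (TangentSpace I : M → Type _))
    (f : C^∞⟮I, M; 𝓘(ℝ, ℝ), ℝ⟯) (x : M) :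
    TensorialAt I E (fun Y : Π x : M, TangentSpace I x ↦
      d% (fun y ↦ d% f y (Y y)) x - d% f x ∘L cov Y x) x where
  smul {g Y} hg hY := by
    have h1 : (fun y ↦ d% f y ((g • Y) y)) = fun y ↦ g y * d% f y (Y y) := by
      ext y; simp
    rw [h1, mvfderiv_fun_mul hg (mdifferentiableAt_mvfderiv_apply f hY),
      cov.isCovariantDerivativeOnUniv.leibniz hY hg]
    ext v
    simp
    ring
  add {Y Y'} hY hY' := by
    have h1 : (fun y ↦ d% f y ((Y + Y') y)) = fun y ↦ d% f y (Y y) + d% f y (Y' y) := by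
      ext y; simp
    rw [h1, mvfderiv_fun_add (mdifferentiableAt_mvfderiv_apply f hY)
      (mdifferentiableAt_mvfderiv_apply f hY'), cov.isCovariantDerivativeOnUniv.add hY hY']
    ext v
    simp
    ring

/-- The Hessian tensor `Hess_f = ∇ ∇ f = ∇ (df)`, i.e. `Hess_f (X, Y) = X (Y f) - (∇_X Y) f`,
as a bilinear form on each tangent space; see `hessian_apply`. -/
def hessian (cov : CovariantDerivative I E (TangentSpace I : M → Type _))
    (f : C^∞⟮I, M; 𝓘(ℝ, ℝ), ℝ⟯) (x : M) :
    TangentSpace I x →L[ℝ] TangentSpace I x →L[ℝ] ℝ :=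
  TensorialAt.mkHom₂ (I := I) (F := E) (F' := E)
    (fun X Y : Π x : M, TangentSpace I x ↦
      d% (fun y ↦ d% f y (Y y)) x (X x) - d% f x (cov Y x (X x))) x
    (fun Y _ ↦ ⟨fun _ _ ↦ by simp [mul_sub], fun _ _ ↦ by simp; ring⟩)
    (fun X _ ↦ ⟨fun hg hY ↦ congr($((hessian_tensorial cov f x).smul hg hY) (X x)),
      fun hY hY' ↦ congr($((hessian_tensorial cov f x).add hY hY') (X x))⟩)

theorem hessian_apply (cov : CovariantDerivative I E (TangentSpace I : M → Type _))
    (f : C^∞⟮I, M; 𝓘(ℝ, ℝ), ℝ⟯) {x : M} {X Y : Π x : M, TangentSpace I x}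
    (hX : MDiffAt (T% X) x) (hY : MDiffAt (T% Y) x) :
    hessian cov f x (X x) (Y x)
      = d% (fun y ↦ d% f y (Y y)) x (X x) - d% f x (cov Y x (X x)) :=
  TensorialAt.mkHom₂_apply _ _ hX hY

/-- The velocity `γ'(t)` of a curve defined on `J` (one-sided at an endpoint contained in `J`). -/
def velocity (I : ModelWithCorners ℝ E H) (γ : ℝ → M) (J : Set ℝ) (t : ℝ) : TangentSpace I (γ t) :=
  mfderivWithin 𝓘(ℝ, ℝ) I γ J t (1 : ℝ)

/-- The covariant derivative `DV/dt` of a vector field `V` along `γ : J → M`. In the local frame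
`(e_i)` of the tangent bundle given by its preferred trivialization (the coordinate frame) at `γ t`,
`DV/dt = ∑ (V^i)'(t) e_i + ∑ V^i(t) ∇_{γ'(t)} e_i`; the section `extend E (V t)` is the
constant-coefficient field `∑ V^i(t) e_i`. -/
def covDerivAlong (cov : CovariantDerivative I E (TangentSpace I : M → Type _))
    (γ : ℝ → M) (J : Set ℝ) (V : Π t : ℝ, TangentSpace I (γ t)) (t : ℝ) : TangentSpace I (γ t) :=
  letI e := trivializationAt E (TangentSpace I : M → Type _) (γ t)
  e.symmL ℝ (γ t) (derivWithin (fun s ↦ (e ⟨γ s, V s⟩).2) J t)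
    + cov (extend E (V t)) (γ t) (velocity I γ J t)

/-- A connection in the local frame given by the preferred trivialization at `x`. -/
theorem cov_eq_trivialization (cov : CovariantDerivative I E (TangentSpace I : M → Type _))
    {x : M} {Y : Π x : M, TangentSpace I x} (hY : MDiffAt (T% Y) x) (v : TangentSpace I x) :
    cov Y x v = (trivializationAt E (TangentSpace I : M → Type _) x).symmL ℝ x
        (d% (fun y ↦ (trivializationAt E (TangentSpace I : M → Type _) x ⟨y, Y y⟩).2) x v)
      + cov (extend E (Y x)) x v := by
  set e := trivializationAt E (TangentSpace I : M → Type _) x with he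
  have hx : x ∈ e.baseSet := FiberBundle.mem_baseSet_trivializationAt' x
  have hmem : ∀ᶠ y in nhds x, y ∈ e.baseSet := e.open_baseSet.mem_nhds hx
  have hd {Y : Π x : M, TangentSpace I x} (hY : MDiffAt (T% Y) x) :
      MDiffAt (fun y ↦ (e ⟨y, Y y⟩).2) x := ((mdifferentiableAt_totalSpace _ _).1 hY).2
  have hcongr {a b : M → E} (h : ∀ᶠ y in nhds x, a y = b y) : d% a x = d% b x := by
    ext1 w
    exact congr($(Filter.EventuallyEq.mfderiv_eq (I := I) (I' := 𝓘(ℝ, E)) h) w)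
  have key : TensorialAt I E (fun Y : Π x : M, TangentSpace I x ↦
      cov Y x v - e.symmL ℝ x (d% (fun y ↦ (e ⟨y, Y y⟩).2) x v)) x := by
    constructor
    · intro g Y hg hY
      have h1 : d% (fun y ↦ (e ⟨y, (g • Y) y⟩).2) x = d% (fun y ↦ g y • (e ⟨y, Y y⟩).2) x := by
        refine hcongr (hmem.mono fun y hy ↦ ?_)
        exact (e.linear ℝ hy).map_smul (g y) (Y y)
      have h2 : e.symmL ℝ x (e ⟨x, Y x⟩).2 = Y x := by
        rw [e.symmL_apply hx]; exact e.symm_apply_apply_mk hx (Y x)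
      rw [h1, mvfderiv_fun_smul hg (hd hY), cov.isCovariantDerivativeOnUniv.leibniz hY hg]
      simp only [_root_.add_apply, _root_.smul_apply, ContinuousLinearMap.smulRight_apply, map_add,
        map_smul, h2]
      module
    · intro Y Y' hY hY'
      have h1 : d% (fun y ↦ (e ⟨y, (Y + Y') y⟩).2) x
          = d% (fun y ↦ (e ⟨y, Y y⟩).2 + (e ⟨y, Y' y⟩).2) x := by
        refine hcongr (hmem.mono fun y hy ↦ ?_)
        exact (e.linear ℝ hy).map_add (Y y) (Y' y)
      rw [h1, mvfderiv_fun_add (hd hY) (hd hY'), cov.isCovariantDerivativeOnUniv.add hY hY']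
      simp
      module
  have h0 : d% (fun y ↦ (e ⟨y, extend E (Y x) y⟩).2) x = 0 := by
    rw [hcongr (b := fun _ ↦ (e ⟨x, Y x⟩).2) (hmem.mono fun y hy ↦ ?_), mvfderiv_const]
    have h := congr_arg Prod.snd (e.apply_mk_symm hy (e ⟨x, Y x⟩).2)
    exact h
  have := key.pointwise hY (mdifferentiableAt_extend ..) (extend_apply_self E (Y x)).symm
  simp only [h0] at this
  simp only [_root_.zero_apply, map_zero, sub_zero, sub_eq_iff_eq_add] at this
  rw [this, add_comm]

/-- If `V` is the restriction to `γ` of a vector field `Y`, then `DV/dt = ∇_{γ'} Y`. -/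
theorem covDerivAlong_comp (cov : CovariantDerivative I E (TangentSpace I : M → Type _))
    {γ : ℝ → M} {J : Set ℝ} {t : ℝ} (hJ : UniqueDiffWithinAt ℝ J t)
    (hγ : MDifferentiableWithinAt 𝓘(ℝ, ℝ) I γ J t)
    {Y : Π x : M, TangentSpace I x} (hY : MDiffAt (T% Y) (γ t)) :
    covDerivAlong cov γ J (fun s ↦ Y (γ s)) t = cov Y (γ t) (velocity I γ J t) := by
  rw [cov_eq_trivialization cov hY, covDerivAlong]
  have hd := ((mdifferentiableAt_totalSpace _ _).1 hY).2
  congr 2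
  have h := mfderiv_comp_mfderivWithin t hd hγ hJ.uniqueMDiffWithinAt
  rw [mfderivWithin_eq_fderivWithin] at h
  exact congr($h (1 : ℝ))

variable [RiemannianBundle (fun x : M ↦ TangentSpace I x)]
  [IsContMDiffRiemannianBundle I ∞ E (fun x : M ↦ TangentSpace I x)]

variable (I) in
/-- `γ` is a geodesic of the Levi-Civita connection on the interval `J`: a `C^2` curve (hence, by
the geodesic equation, a smooth one) with `Dγ'/dt = 0` on `J`. -/
structure IsGeodesicOn (γ : ℝ → M) (J : Set ℝ) : Prop where
  contMDiffOn : ContMDiffOn 𝓘(ℝ, ℝ) I 2 γ J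
  acceleration_eq_zero : ∀ t ∈ J,
    covDerivAlong (leviCivita I M) γ J (fun s ↦ velocity I γ J s) t = 0

end Hessian

end RiemannianHessian

end

noncomputable section

namespace RiemannianHessian

set_option linter.unusedSectionVars false

/-! ### Leibniz rules along a curve. -/

section CovariantDerivativeAlong

variable {E : Type*} [NormedAddCommGroup E] [NormedSpace ℝ E] [FiniteDimensional ℝ E]
  {H : Type*} [TopologicalSpace H] {I : ModelWithCorners ℝ E H}
  {M : Type*} [TopologicalSpace M] [ChartedSpace H M] [IsManifold I ∞ M]

/-! Along a geodesic the Leibniz rule gives `(f ∘ γ)'' = Hess_f (γ', γ')`, because the remaining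
term `df (Dγ'/dt)` vanishes (`hasDerivWithinAt_mvfderiv_apply`,
`IsGeodesicOn.hasDerivWithinAt_mvfderiv_velocity`). If the Hessian is zero, `f ∘ γ` has constant
derivative and is affine.

Conversely, affinity makes `Hess_f (w, w)` vanish for every velocity `w` of a geodesic. At a point
interior to a chart every `w` occurs: the geodesic equation is a first-order system on `E × E` with
C^1 right-hand side, and Picard–Lindelöf applies (`exists_isGeodesicOn`). The Hessian is symmetric
(`hessian_leviCivita_symm`), so polarization kills it. At a boundary point a geodesic with
prescribed velocity may fail to exist; there the Hessian vanishes as a limit from the chart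
interior, which accumulates at every point (`hessian_eq_zero_of_affine`). Both the ODE and the limit
rest on the C^1 regularity of the Levi-Civita connection, extracted from the Koszul formula
(`contMDiffAt_leviCivita`). -/

theorem mdifferentiableAt_sum_const_smul {ι : Type*} (s : Finset ι) (c : ι → ℝ) {x : M}
    {Y : ι → Π x : M, TangentSpace I x} (hY : ∀ i, MDiffAt (T% (Y i)) x) :
    MDiffAt (T% (fun y ↦ ∑ i ∈ s, c i • Y i y)) x :=
  MDifferentiableAt.sum_section (fun i _ ↦ mdifferentiableAt_const.smul_section (hY i))

theorem cov_sum_const_smul (cov : CovariantDerivative I E (TangentSpace I : M → Type _))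
    {ι : Type*} (s : Finset ι) (c : ι → ℝ) {x : M}
    {Y : ι → Π x : M, TangentSpace I x} (hY : ∀ i, MDiffAt (T% (Y i)) x) :
    cov (fun y ↦ ∑ i ∈ s, c i • Y i y) x = ∑ i ∈ s, c i • cov (Y i) x := by
  classical
  induction s using Finset.induction_on with
  | empty => exact congr_fun cov.zero x
  | insert a s ha ih =>
    simp only [Finset.sum_insert ha]
    rw [← ih, ← cov.isCovariantDerivativeOnUniv.smul_const _ (hY a)]
    exact cov.isCovariantDerivativeOnUniv.add (mdifferentiableAt_const.smul_section (hY a))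
      (mdifferentiableAt_sum_const_smul s c hY)

theorem hasDerivWithinAt_comp_of_mdifferentiableAt {F : Type*} [NormedAddCommGroup F]
    [NormedSpace ℝ F] {g : M → F}
    {γ : ℝ → M} {J : Set ℝ} {t : ℝ}
    (hγ : MDifferentiableWithinAt 𝓘(ℝ, ℝ) I γ J t) (hg : MDiffAt g (γ t)) :
    HasDerivWithinAt (fun s ↦ g (γ s)) (d% g (γ t) (velocity I γ J t)) J t := by
  have h := hg.hasMFDerivAt.comp_hasMFDerivWithinAt t hγ.hasMFDerivWithinAt
  let L : ℝ →L[ℝ] F := d% g (γ t) ∘L mfderivWithin 𝓘(ℝ, ℝ) I γ J t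
  have h' : HasFDerivWithinAt (fun s ↦ g (γ s)) L J t :=
    hasMFDerivWithinAt_iff_hasFDerivWithinAt.1 h
  exact h'.hasDerivWithinAt

/-- Leibniz rule for the covariant derivative along a curve. -/
theorem covDerivAlong_sum_smul (cov : CovariantDerivative I E (TangentSpace I : M → Type _))
    {γ : ℝ → M} {J : Set ℝ} {t : ℝ} (hJ : UniqueDiffWithinAt ℝ J t) (ht : t ∈ J)
    (hγ : MDifferentiableWithinAt 𝓘(ℝ, ℝ) I γ J t) {ι : Type*} [Fintype ι]
    {Y : ι → Π x : M, TangentSpace I x} (hY : ∀ i, MDiffAt (T% (Y i)) (γ t))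
    {c : ι → ℝ → ℝ} {c' : ι → ℝ} (hc : ∀ i, HasDerivWithinAt (c i) (c' i) J t)
    {V : Π t : ℝ, TangentSpace I (γ t)}
    (hV : ∀ᶠ s in nhdsWithin t J, V s = ∑ i, c i s • Y i (γ s)) :
    covDerivAlong cov γ J V t =
      ∑ i, (c' i • Y i (γ t) + c i t • cov (Y i) (γ t) (velocity I γ J t)) := by
  -- Freeze the coefficients at time `t`. The field `W` agrees with `V` at `t`, so the connection
  -- terms coincide and `covDerivAlong_comp` handles `W`; only the derivatives of the trivialized
  -- components differ, by `∑ c' i • Y i`.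
  set W : Π x : M, TangentSpace I x := fun y ↦ ∑ i, c i t • Y i y with hW
  have hWd : MDiffAt (T% W) (γ t) := mdifferentiableAt_sum_const_smul _ _ hY
  have hcomp := covDerivAlong_comp cov hJ hγ hWd
  rw [cov_sum_const_smul cov _ _ hY] at hcomp
  have hVt : V t = W (γ t) := hV.self_of_nhdsWithin ht
  rw [covDerivAlong] at hcomp ⊢
  rw [hVt, Finset.sum_add_distrib]
  have hsum : (∑ i, c i t • cov (Y i) (γ t)) (velocity I γ J t) =
      ∑ i, c i t • cov (Y i) (γ t) (velocity I γ J t) := by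
    simp
  rw [← hsum, ← hcomp, ← add_assoc]
  congr 1
  set e := trivializationAt E (TangentSpace I : M → Type _) (γ t) with he
  have hx : γ t ∈ e.baseSet := FiberBundle.mem_baseSet_trivializationAt' _
  have hmem : ∀ᶠ s in nhdsWithin t J, γ s ∈ e.baseSet :=
    hγ.continuousWithinAt (e.open_baseSet.mem_nhds hx)
  have hd {Y : Π x : M, TangentSpace I x} (hY : MDiffAt (T% Y) (γ t)) :
      MDiffAt (fun y ↦ (e ⟨y, Y y⟩).2) (γ t) := ((mdifferentiableAt_totalSpace _ _).1 hY).2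
  have hlin {y : M} (hy : y ∈ e.baseSet) (a : ι → ℝ) :
      (e ⟨y, ∑ i, a i • Y i y⟩).2 = ∑ i, a i • (e ⟨y, Y i y⟩).2 := by
    refine (map_sum (e.linear ℝ hy).mk' (fun i ↦ a i • Y i y) Finset.univ).trans ?_
    exact Finset.sum_congr rfl fun i _ ↦ (e.linear ℝ hy).map_smul (a i) (Y i y)
  have hYd (i) := hasDerivWithinAt_comp_of_mdifferentiableAt hγ (hd (hY i))
  have h1 : HasDerivWithinAt (fun s ↦ (e ⟨γ s, W (γ s)⟩).2)
      (∑ i, c i t • d% (fun y ↦ (e ⟨y, Y i y⟩).2) (γ t) (velocity I γ J t)) J t :=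
    (HasDerivWithinAt.fun_sum fun i _ ↦ (hYd i).const_smul (c i t)).congr_of_eventuallyEq
      (hmem.mono fun s hs ↦ hlin hs _) (hlin hx _)
  have h2 : HasDerivWithinAt (fun s ↦ (e ⟨γ s, V s⟩).2)
      (∑ i, (c i t • d% (fun y ↦ (e ⟨y, Y i y⟩).2) (γ t) (velocity I γ J t)
        + c' i • (e ⟨γ t, Y i (γ t)⟩).2)) J t :=
    (HasDerivWithinAt.fun_sum fun i _ ↦ (hc i).smul (hYd i)).congr_of_eventuallyEq
      ((hmem.and hV).mono fun s hs ↦ by simpa only [hs.2] using! hlin hs.1 _)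
      (by rw [hVt]; exact hlin hx _)
  rw [h1.derivWithin hJ, h2.derivWithin hJ, Finset.sum_add_distrib, map_add, add_comm]
  congr 1
  rw [map_sum]
  refine Finset.sum_congr rfl fun i _ ↦ ?_
  rw [map_smul, e.symmL_apply hx, e.symm_apply_apply_mk hx]

/-- The derivative of `df (V)` along a curve is `Hess_f (γ', V) + df (DV/dt)`. -/
theorem hasDerivWithinAt_mvfderiv_apply
    (cov : CovariantDerivative I E (TangentSpace I : M → Type _)) (f : C^∞⟮I, M; 𝓘(ℝ, ℝ), ℝ⟯)
    {γ : ℝ → M} {J : Set ℝ} {t : ℝ} (hJ : UniqueDiffWithinAt ℝ J t) (ht : t ∈ J)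
    (hγ : MDifferentiableWithinAt 𝓘(ℝ, ℝ) I γ J t) {ι : Type*} [Fintype ι]
    {Y : ι → Π x : M, TangentSpace I x} (hY : ∀ i, MDiffAt (T% (Y i)) (γ t))
    {c : ι → ℝ → ℝ} {c' : ι → ℝ} (hc : ∀ i, HasDerivWithinAt (c i) (c' i) J t)
    {V : Π t : ℝ, TangentSpace I (γ t)}
    (hV : ∀ᶠ s in nhdsWithin t J, V s = ∑ i, c i s • Y i (γ s)) :
    HasDerivWithinAt (fun s ↦ d% f (γ s) (V s))
      (hessian cov f (γ t) (velocity I γ J t) (V t) + d% f (γ t) (covDerivAlong cov γ J V t)) J t := by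
  have h1 := HasDerivWithinAt.fun_sum (u := Finset.univ) fun i _ ↦ (hc i).smul
    (hasDerivWithinAt_comp_of_mdifferentiableAt hγ (mdifferentiableAt_mvfderiv_apply f (hY i)))
  have hVt := hV.self_of_nhdsWithin ht
  have h2 := h1.congr_of_eventuallyEq (f₁ := fun s ↦ d% f (γ s) (V s))
    (hV.mono fun s hs ↦ by simp [hs, map_sum]) (by simp [hVt, map_sum])
  suffices h : hessian cov f (γ t) (velocity I γ J t) (V t)
      + d% f (γ t) (covDerivAlong cov γ J V t) = _ by rw [h]; exact h2
  have hX : MDiffAt (T% (extend E (velocity I γ J t))) (γ t) := mdifferentiableAt_extend ..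
  -- Summand by summand: `c i t * γ' (Y_i f)` splits into a Hessian term and `c i t * df (∇_{γ'}
  -- Y_i)`, while `c' i * Y_i f` supplies the rest of `df (DV/dt)`.
  rw [covDerivAlong_sum_smul cov hJ ht hγ hY hc hV, hVt, map_sum, map_sum, ← Finset.sum_add_distrib]
  refine Finset.sum_congr rfl fun i _ ↦ ?_
  have := hessian_apply cov f hX (hY i)
  rw [extend_apply_self] at this
  rw [map_smul, this, map_add, map_smul, map_smul]
  simp only [smul_eq_mul]
  ring

end CovariantDerivativeAlong

/-! ### C^1 regularity of the Levi-Civita connection. -/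

section Smoothness

variable {E : Type*} [NormedAddCommGroup E] [NormedSpace ℝ E] [FiniteDimensional ℝ E]
  {H : Type*} [TopologicalSpace H] {I : ModelWithCorners ℝ E H}
  {M : Type*} [TopologicalSpace M] [ChartedSpace H M] [IsManifold I ∞ M]

theorem contMDiffAt_mvfderiv_apply {m n : ℕ∞} {g : M → ℝ} {X : Π x : M, TangentSpace I x} {x : M}
    (hg : CMDiffAt n g x) (hX : CMDiffAt m (T% X) x) (hmn : (m + 1 : ℕ∞ω) ≤ n) :
    CMDiffAt m (fun y ↦ d% g y (X y)) x := by
  have h1 := ContMDiffAt.mfderiv_const hg hmn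
  have h2 := ContMDiffAt.clm_apply_of_inCoordinates (ϕ := fun y ↦ mfderiv I 𝓘(ℝ, ℝ) g y) h1 hX
    (hg.of_le (le_self_add.trans hmn))
  have h3 := (contMDiffAt_totalSpace.1 h2).2
  have h4 : ContMDiffAt (M' := ℝ) I 𝓘(ℝ, ℝ) m
      (fun y ↦ mfderiv I 𝓘(ℝ, ℝ) g y (X y)) x := by
    simpa using h3
  exact h4

theorem contMDiffAt_det {ι : Type*} [Fintype ι] [DecidableEq ι] {n : ℕ∞} {x : M}
    {A : M → Matrix ι ι ℝ} (hA : ∀ i j, CMDiffAt n (fun y ↦ A y i j) x) :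
    CMDiffAt n (fun y ↦ (A y).det) x := by
  simp only [Matrix.det_apply']
  refine ContMDiffAt.sum fun σ _ ↦ contMDiffAt_const.mul (contMDiffAt_finsetProd fun i _ ↦ hA _ _)

variable [RiemannianBundle (fun x : M ↦ TangentSpace I x)]
  [IsContMDiffRiemannianBundle I ∞ E (fun x : M ↦ TangentSpace I x)]

theorem contMDiffAt_inner {n : ℕ∞} {X Y : Π x : M, TangentSpace I x} {x : M}
    (hX : CMDiffAt n (T% X) x) (hY : CMDiffAt n (T% Y) x) :
    CMDiffAt n (fun y ↦ inner ℝ (X y) (Y y)) x := by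
  have : IsContMDiffRiemannianBundle I n E (fun x : M ↦ TangentSpace I x) :=
    IsContMDiffRiemannianBundle.of_le (n := ∞) (by exact_mod_cast le_top)
  exact ContMDiffAt.inner_bundle (IB := I) (F := E) (E := fun x : M ↦ TangentSpace I x)
    (b := fun y ↦ y) (v := X) (w := Y) hX hY

theorem contMDiffAt_koszul {X Y Z : Π x : M, TangentSpace I x} {x : M}
    (hX : CMDiffAt 2 (T% X) x) (hY : CMDiffAt 2 (T% Y) x) (hZ : CMDiffAt 2 (T% Z) x) :
    CMDiffAt 1 (koszul X Y Z) x := by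
  have hi {U V W : Π x : M, TangentSpace I x} (hU : CMDiffAt 2 (T% U) x)
      (hV : CMDiffAt 2 (T% V) x) (hW : CMDiffAt 2 (T% W) x) :
      CMDiffAt 1 (fun y ↦ d% (fun z ↦ inner ℝ (U z) (V z)) y (W y)) x :=
    contMDiffAt_mvfderiv_apply (m := 1) (n := 2) (contMDiffAt_inner (n := 2) hU hV)
      (hW.of_le (by norm_num)) (by norm_num)
  have hb {U V W : Π x : M, TangentSpace I x} (hU : CMDiffAt 2 (T% U) x)
      (hV : CMDiffAt 2 (T% V) x) (hW : CMDiffAt 2 (T% W) x) :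
      CMDiffAt 1 (fun y ↦ inner ℝ (mlieBracket I U V y) (W y)) x := by
    have : IsManifold I (((2 : ℕ∞) : ℕ∞ω) + 1) M := IsManifold.of_le (n := ∞) (by
      rw [show ((2 : ℕ∞) : ℕ∞ω) + 1 = ((3 : ℕ∞) : ℕ∞ω) by norm_num]
      exact_mod_cast le_top)
    have : IsManifold I (minSmoothness ℝ 2) M := by simpa using inferInstanceAs (IsManifold I 2 M)
    have : IsManifold I (minSmoothness ℝ 3) M := by simpa using inferInstanceAs (IsManifold I 3 M)
    refine contMDiffAt_inner (n := 1) (ContMDiffAt.mlieBracket_vectorField (m := 1) (n := 2) hU hV ?_)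
      (hW.of_le (by norm_num))
    simp
    norm_num
  exact contMDiffAt_const.mul (((((hi hY hZ hX).add (hi hX hZ hY)).sub (hi hX hY hZ)).add
    (hb hX hY hZ)).sub (hb hX hZ hY)|>.sub (hb hY hZ hX))

/-- In a local frame the coefficients of `∇_X Y` solve a linear system whose matrix is the Gram
matrix of the frame and whose right-hand side is the Koszul expression against the frame. Cramer's
rule writes them as quotients of C^1 functions. -/
theorem contMDiffAt_leviCivita {X Y : Π x : M, TangentSpace I x} {x : M}
    (hX : CMDiffAt 2 (T% X) x) (hY : CMDiffAt 2 (T% Y) x) :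
    CMDiffAt 1 (T% (fun y ↦ leviCivita I M Y y (X y))) x := by
  classical
  set e := trivializationAt E (TangentSpace I : M → Type _) x with he
  have hx : x ∈ e.baseSet := FiberBundle.mem_baseSet_trivializationAt' x
  let b := Module.finBasis ℝ E
  have hs (i) {y : M} (hy : y ∈ e.baseSet) : CMDiffAt 2 (T% (e.localFrame b i)) y :=
    contMDiffAt_localFrame_of_mem 2 e b i hy
  let G (y : M) : Matrix _ _ ℝ := Matrix.gram ℝ (fun i ↦ e.localFrame b i y)
  let κ (y : M) (i) : ℝ := koszul X Y (e.localFrame b i) y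
  have hG (i j) : CMDiffAt 1 (fun y ↦ G y i j) x :=
    contMDiffAt_inner (n := 1) ((hs i hx).of_le (by norm_num)) ((hs j hx).of_le (by norm_num))
  have hκ (i) : CMDiffAt 1 (fun y ↦ κ y i) x := contMDiffAt_koszul hX hY (hs i hx)
  have hdet {y : M} (hy : y ∈ e.baseSet) : (G y).det ≠ 0 := by
    rw [Matrix.det_gram_ne_zero_iff_linearIndependent]
    exact (e.isLocalFrameOn_localFrame_baseSet I 1 b).linearIndependent hy
  rw [contMDiffAt_iff_localFrameCoeff b hx]
  intro l
  have hl : CMDiffAt 1 (fun y ↦ (G y).cramer (κ y) l / (G y).det) x := by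
    refine ContMDiffAt.div₀ ?_ (contMDiffAt_det (n := 1) hG) (hdet hx)
    simp only [Matrix.cramer_apply]
    refine contMDiffAt_det (n := 1) fun i j ↦ ?_
    -- In the Cramer determinant, column `l` of the Gram matrix is replaced by `κ`.
    by_cases hj : j = l
    · subst hj; simpa using hκ i
    · simpa [hj] using hG i j
  refine hl.congr_of_eventuallyEq ?_
  filter_upwards [e.open_baseSet.mem_nhds hx,
    (contMDiffAt_iff_contMDiffAt_nhds (by simp)).1 hX,
    (contMDiffAt_iff_contMDiffAt_nhds (by simp)).1 hY] with y hy hXy hYy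
  have hXd := hXy.mdifferentiableAt (by simp)
  have hYd := hYy.mdifferentiableAt (by simp)
  set c : _ → ℝ := fun l ↦ e.localFrameCoeff I b l y (leviCivita I M Y y (X y)) with hc
  have hsum : leviCivita I M Y y (X y) = ∑ i, c i • e.localFrame b i y :=
    e.eq_sum_localFrameCoeff_smul (s := fun y ↦ leviCivita I M Y y (X y)) hy
  have hmul : (G y).mulVec c = κ y := by
    ext k
    have h1 := inner_leviCivitaFun hXd hYd ((hs k hy).mdifferentiableAt (by simp))
    change inner ℝ (leviCivita I M Y y (X y)) _ = _ at h1
    rw [hsum, sum_inner] at h1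
    simp only [κ, ← h1, Matrix.mulVec, dotProduct, G, Matrix.gram_apply, inner_smul_left]
    refine Finset.sum_congr rfl fun i _ ↦ ?_
    rw [real_inner_comm]; simp [mul_comm]
  change c l = _
  rw [eq_div_iff (hdet hy), ← hmul, Matrix.cramer_eq_adjugate_mulVec, Matrix.mulVec_mulVec,
    Matrix.adjugate_mul]
  simp [Matrix.smul_mulVec, mul_comm]

end Smoothness

/-! ### Symmetry of the Hessian. -/

section Symmetry

variable {E : Type*} [NormedAddCommGroup E] [NormedSpace ℝ E] [FiniteDimensional ℝ E]
  {H : Type*} [TopologicalSpace H] {I : ModelWithCorners ℝ E H}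
  {M : Type*} [TopologicalSpace M] [ChartedSpace H M] [IsManifold I ∞ M]

/-- The preferred trivialization of the tangent bundle at `x` is the derivative of the chart. Hence
`extend E w` is a constant field in the chart, which the next lemmas exploit. -/
theorem mfderivWithin_extChartAt_symm_apply {x : M} {z : E} (hz : z ∈ (extChartAt I x).target)
    (w : E) :
    mfderivWithin 𝓘(ℝ, E) I (extChartAt I x).symm (Set.range I) z w =
      (trivializationAt E (TangentSpace I : M → Type _) x).symm ((extChartAt I x).symm z) w := by
  set y := (extChartAt I x).symm z with hy
  have hys : y ∈ (chartAt H x).source := by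
    rw [← extChartAt_source I]
    exact (extChartAt I x).map_target hz
  have h := TangentBundle.symmL_trivializationAt (𝕜 := ℝ) (I := I) hys
  rw [(extChartAt I x).right_inv hz] at h
  have h' := congr($h w)
  rw [Trivialization.symmL_apply _ (by simpa using hys)] at h'
  exact h'.symm

theorem mvfderiv_apply_extend_extChartAt_symm (f : C^∞⟮I, M; 𝓘(ℝ, ℝ), ℝ⟯) {x : M} (w : TangentSpace I x)
    {z : E} (hz : z ∈ (extChartAt I x).target) :
    d% f ((extChartAt I x).symm z) (extend E w ((extChartAt I x).symm z)) =
      fderivWithin ℝ (f ∘ (extChartAt I x).symm) (Set.range I) z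
        ((trivializationAt E (TangentSpace I : M → Type _) x) ⟨x, w⟩).2 := by
  have hz' : z ∈ Set.range I := extChartAt_target_subset_range x hz
  have h := mfderiv_comp_mfderivWithin z (f.mdifferentiableAt (x := (extChartAt I x).symm z))
    (mdifferentiableWithinAt_extChartAt_symm hz) (I.uniqueDiffOn z hz').uniqueMDiffWithinAt
  rw [mfderivWithin_eq_fderivWithin] at h
  rw [h]
  change _ = d% f ((extChartAt I x).symm z) (mfderivWithin 𝓘(ℝ, E) I (extChartAt I x).symm (Set.range I) z _)
  rw [mfderivWithin_extChartAt_symm_apply hz]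
  rfl

theorem contDiffWithinAt_comp_extChartAt_symm (f : C^∞⟮I, M; 𝓘(ℝ, ℝ), ℝ⟯) (x : M) :
    ContDiffWithinAt ℝ 2 (f ∘ (extChartAt I x).symm) (Set.range I) (extChartAt I x x) := by
  have h2 : ((2 : ℕ∞) : ℕ∞ω) ≤ ∞ := by exact_mod_cast le_top
  have h := (f.contMDiff.of_le h2).comp_contMDiffOn (contMDiffOn_extChartAt_symm (n := 2) (I := I) x)
  exact ((h _ (mem_extChartAt_target x)).contDiffWithinAt).mono_of_mem_nhdsWithin
    (extChartAt_target_mem_nhdsWithin x)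

theorem fderivWithin_clm_apply_const {F G K : Type*} [NormedAddCommGroup F] [NormedSpace ℝ F]
    [NormedAddCommGroup G] [NormedSpace ℝ G] [NormedAddCommGroup K] [NormedSpace ℝ K]
    {g : F → G →L[ℝ] K} {s : Set F} {x : F} (hg : DifferentiableWithinAt ℝ g s x)
    (hs : UniqueDiffWithinAt ℝ s x) (v : F) (w : G) :
    fderivWithin ℝ (fun z ↦ g z w) s x v = fderivWithin ℝ g s x v w := by
  rw [fderivWithin_clm_apply hs hg (differentiableWithinAt_const _)]
  simp

theorem mvfderiv_mvfderiv_extend (f : C^∞⟮I, M; 𝓘(ℝ, ℝ), ℝ⟯) {x : M} (v w : TangentSpace I x) :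
    d% (fun y ↦ d% f y (extend E w y)) x v =
      fderivWithin ℝ (fderivWithin ℝ (f ∘ (extChartAt I x).symm) (Set.range I)) (Set.range I)
        (extChartAt I x x) v w := by
  have hd := mdifferentiableAt_mvfderiv_apply f (mdifferentiableAt_extend I E w)
  have hx : extChartAt I x x ∈ Set.range I := extChartAt_target_subset_range x (mem_extChartAt_target x)
  have hu := I.uniqueDiffOn _ hx
  have hF := contDiffWithinAt_comp_extChartAt_symm f x
  have hF' := (hF.fderivWithin_right (m := 1) I.uniqueDiffOn (by norm_num) hx).differentiableWithinAt (by simp)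
  -- At its own base point the trivialization is the identity of `E`.
  have hw : ((trivializationAt E (TangentSpace I : M → Type _) x) ⟨x, w⟩).2 = w :=
    (tangentBundleCore I M).coordChange_self (achart H x) x (mem_chart_source H x) w
  have h1 : (d% (fun y ↦ d% f y (extend E w y)) x v : ℝ) =
      fderivWithin ℝ ((fun y ↦ d% f y (extend E w y)) ∘ (extChartAt I x).symm) (Set.range I)
        (extChartAt I x x) v := by
    change mfderiv I 𝓘(ℝ, ℝ) _ x v = _
    rw [hd.mfderiv]
    rfl
  rw [h1]
  have h2 : (fun y ↦ (d% f y (extend E w y) : ℝ)) ∘ (extChartAt I x).symm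
      =ᶠ[nhdsWithin (extChartAt I x x) (Set.range I)]
      fun z ↦ fderivWithin ℝ (f ∘ (extChartAt I x).symm) (Set.range I) z w :=
    Filter.eventuallyEq_of_mem (extChartAt_target_mem_nhdsWithin x) fun z hz ↦
     (mvfderiv_apply_extend_extChartAt_symm f w hz).trans (by rw [hw])
  rw [h2.fderivWithin_eq_of_mem hx]
  exact fderivWithin_clm_apply_const hF' hu v w

/-- Both fields are constant when pulled back to the chart. -/
theorem mlieBracket_extend {x : M} (v w : TangentSpace I x) :
    mlieBracket I (extend E v) (extend E w) x = 0 := by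
  have h (v : TangentSpace I x) :
      mpullbackWithin 𝓘(ℝ, E) I (extChartAt I x).symm (extend E v) (Set.range I)
        =ᶠ[nhdsWithin (extChartAt I x x) (Set.range I)]
        fun _ ↦ ((trivializationAt E (TangentSpace I : M → Type _) x) ⟨x, v⟩).2 :=
    Filter.eventuallyEq_of_mem (extChartAt_target_mem_nhdsWithin x) fun z hz ↦ by
      refine (isInvertible_mfderivWithin_extChartAt_symm hz).inverse_apply_eq.2 ?_
      rw [mfderivWithin_extChartAt_symm_apply hz]
      rfl
  have hx : extChartAt I x x ∈ Set.range I := extChartAt_target_subset_range x (mem_extChartAt_target x)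
  rw [mlieBracket, mlieBracketWithin_apply, Set.preimage_univ, Set.univ_inter,
    (h v).lieBracketWithin_vectorField_eq ((h v).self_of_nhdsWithin hx) (h w) ((h w).self_of_nhdsWithin hx)]
  simp only [lieBracketWithin, fderivWithin_fun_const, Pi.zero_apply, _root_.zero_apply, sub_self]
  exact map_zero _

variable [RiemannianBundle (fun x : M ↦ TangentSpace I x)]
  [IsContMDiffRiemannianBundle I ∞ E (fun x : M ↦ TangentSpace I x)]

/-- On constant-coefficient extensions the bracket vanishes, so zero torsion equates the two
connection terms. What is left is a second derivative within `Set.range I`, symmetric even at the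
boundary because the range lies in the closure of its interior. -/
theorem hessian_leviCivita_symm (f : C^∞⟮I, M; 𝓘(ℝ, ℝ), ℝ⟯) {x : M} (v w : TangentSpace I x) :
    hessian (leviCivita I M) f x v w = hessian (leviCivita I M) f x w v := by
  have hv : MDiffAt (T% (extend E v)) x := mdifferentiableAt_extend ..
  have hw : MDiffAt (T% (extend E w)) x := mdifferentiableAt_extend ..
  have h1 := hessian_apply (leviCivita I M) f hv hw
  have h2 := hessian_apply (leviCivita I M) f hw hv
  have ht := (CovariantDerivative.torsion_eq_zero_iff _).1 (leviCivita_torsion (I := I) (M := M)) hv hw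
  rw [mlieBracket_extend, sub_eq_zero] at ht
  rw [ht] at h1
  simp only [extend_apply_self] at h1 h2
  rw [h1, h2, mvfderiv_mvfderiv_extend, mvfderiv_mvfderiv_extend]
  congr 1
  exact (contDiffWithinAt_comp_extChartAt_symm f x).isSymmSndFDerivWithinAt (by simp)
    I.uniqueDiffOn (I.range_subset_closure_interior (Set.mem_range_self _))
    (Set.mem_range_self _) v w

end Symmetry

/-! ### Vanishing Hessian implies affine along geodesics. -/

section GeodesicAffine

variable {E : Type*} [NormedAddCommGroup E] [NormedSpace ℝ E] [FiniteDimensional ℝ E]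
  {H : Type*} [TopologicalSpace H] {I : ModelWithCorners ℝ E H}
  {M : Type*} [TopologicalSpace M] [ChartedSpace H M] [IsManifold I ∞ M]

theorem symm_eq_sum_localFrame {e : Trivialization E (TotalSpace.proj : TangentBundle I M → M)}
    [MemTrivializationAtlas e] {ι : Type*} [Fintype ι] (b : Module.Basis ι ℝ E) {y : M}
    (hy : y ∈ e.baseSet) (v : E) : e.symm y v = ∑ i, b.repr v i • e.localFrame b i y := by
  have h (i) : e.localFrame b i y = e.symmL ℝ y (b i) := by
    rw [e.localFrame_apply_of_mem_baseSet b hy, e.symmL_apply hy]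
    simp [Trivialization.basisAt]
  simp only [h]
  rw [← e.symmL_apply (R := ℝ) hy]
  conv_lhs => rw [← b.sum_repr v, map_sum]
  simp only [map_smul]

/-- A differentiable vector field along a curve has differentiable coefficients in a local frame. -/
theorem exists_hasDerivWithinAt_localFrame_coeff {γ : ℝ → M} {J : Set ℝ} {t : ℝ}
    {V : Π t : ℝ, TangentSpace I (γ t)}
    (hV : MDifferentiableWithinAt 𝓘(ℝ, ℝ) I.tangent (fun s ↦ (⟨γ s, V s⟩ : TangentBundle I M)) J t) :
    ∃ (n : ℕ) (Y : Fin n → Π x : M, TangentSpace I x) (c : Fin n → ℝ → ℝ) (c' : Fin n → ℝ),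
      (∀ i, MDiffAt (T% (Y i)) (γ t)) ∧ (∀ i, HasDerivWithinAt (c i) (c' i) J t) ∧
      ∀ᶠ s in nhdsWithin t J, V s = ∑ i, c i s • Y i (γ s) := by
  set e := trivializationAt E (TangentSpace I : M → Type _) (γ t) with he
  have hx : γ t ∈ e.baseSet := FiberBundle.mem_baseSet_trivializationAt' _
  let b := Module.finBasis ℝ E
  have h2 := (mdifferentiableWithinAt_totalSpace _ _).1 hV
  have hmem : ∀ᶠ s in nhdsWithin t J, γ s ∈ e.baseSet :=
    h2.1.continuousWithinAt (e.open_baseSet.mem_nhds hx)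
  have hd : DifferentiableWithinAt ℝ (fun s ↦ (e ⟨γ s, V s⟩).2) J t :=
    mdifferentiableWithinAt_iff_differentiableWithinAt.1 h2.2
  let C (i) : E →L[ℝ] ℝ := LinearMap.toContinuousLinearMap (b.coord i)
  refine ⟨_, e.localFrame b, fun i s ↦ C i (e ⟨γ s, V s⟩).2, fun i ↦ _, fun i ↦ ?_,
    fun i ↦ ((C i).hasFDerivAt.comp_hasDerivWithinAt t hd.hasDerivWithinAt), ?_⟩
  · exact (contMDiffAt_localFrame_of_mem 1 e b i hx).mdifferentiableAt (by simp)
  · filter_upwards [hmem] with s hs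
    have := symm_eq_sum_localFrame b hs (e ⟨γ s, V s⟩).2
    rw [e.symm_apply_apply_mk hs] at this
    exact this

/-- The velocity curve is the tangent map of `γ` composed with the unit field `s ↦ (s, 1)`, which
costs one derivative. -/
theorem mdifferentiableWithinAt_velocity {γ : ℝ → M} {J : Set ℝ}
    (hγ : ContMDiffOn 𝓘(ℝ, ℝ) I 2 γ J) (hJ : UniqueDiffOn ℝ J) {t : ℝ} (ht : t ∈ J) :
    MDifferentiableWithinAt 𝓘(ℝ, ℝ) I.tangent
      (fun s ↦ (⟨γ s, velocity I γ J s⟩ : TangentBundle I M)) J t := by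
  have h1 := hγ.contMDiffOn_tangentMapWithin (m := 1) (by norm_num) hJ.uniqueMDiffOn
  have h2 : ContMDiff 𝓘(ℝ, ℝ) 𝓘(ℝ, ℝ).tangent 1
      (fun s : ℝ ↦ (⟨s, (1 : ℝ)⟩ : TangentBundle 𝓘(ℝ, ℝ) ℝ)) :=
    contMDiff_vectorSpace_iff_contDiff.2 contDiff_const
  exact ((h1.comp h2.contMDiffOn fun s hs ↦ hs) t ht).mdifferentiableWithinAt (by simp)

variable [RiemannianBundle (fun x : M ↦ TangentSpace I x)]
  [IsContMDiffRiemannianBundle I ∞ E (fun x : M ↦ TangentSpace I x)]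

theorem IsGeodesicOn.hasDerivWithinAt_comp {γ : ℝ → M} {J : Set ℝ} (hγ : IsGeodesicOn I γ J)
    (f : C^∞⟮I, M; 𝓘(ℝ, ℝ), ℝ⟯) {t : ℝ} (ht : t ∈ J) :
    HasDerivWithinAt (fun s ↦ f (γ s)) (d% f (γ t) (velocity I γ J t)) J t :=
  hasDerivWithinAt_comp_of_mdifferentiableAt
    ((hγ.contMDiffOn t ht).mdifferentiableWithinAt (by simp)) f.mdifferentiableAt

/-- Along a geodesic, `(f ∘ γ)'' = Hess_f (γ', γ')`. -/
theorem IsGeodesicOn.hasDerivWithinAt_mvfderiv_velocity {γ : ℝ → M} {J : Set ℝ}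
    (hγ : IsGeodesicOn I γ J) (hJ : UniqueDiffOn ℝ J) (f : C^∞⟮I, M; 𝓘(ℝ, ℝ), ℝ⟯) {t : ℝ}
    (ht : t ∈ J) :
    HasDerivWithinAt (fun s ↦ d% f (γ s) (velocity I γ J s))
      (hessian (leviCivita I M) f (γ t) (velocity I γ J t) (velocity I γ J t)) J t := by
  obtain ⟨n, Y, c, c', hY, hc, hV⟩ := exists_hasDerivWithinAt_localFrame_coeff
    (mdifferentiableWithinAt_velocity hγ.contMDiffOn hJ ht)
  have h := hasDerivWithinAt_mvfderiv_apply (leviCivita I M) f (hJ t ht) ht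
    ((hγ.contMDiffOn t ht).mdifferentiableWithinAt (by simp)) hY hc hV
  rwa [hγ.acceleration_eq_zero t ht, map_zero, add_zero] at h

theorem uniqueDiffOn_of_ordConnected_of_nontrivial {J : Set ℝ} (hJ : J.OrdConnected)
    (hJ' : J.Nontrivial) : UniqueDiffOn ℝ J := by
  obtain ⟨a, ha, b, hb, hab⟩ := hJ'.exists_lt
  refine uniqueDiffOn_convex hJ.convex ?_
  obtain ⟨c, hc⟩ := Set.nonempty_Ioo.2 hab
  exact ⟨c, interior_maximal (Set.Ioo_subset_Icc_self.trans (hJ.out ha hb)) isOpen_Ioo hc⟩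

theorem IsGeodesicOn.exists_affine_of_hessian_eq_zero {f : C^∞⟮I, M; 𝓘(ℝ, ℝ), ℝ⟯}
    (hf : ∀ p : M, hessian (leviCivita I M) f p = 0) {γ : ℝ → M} {J : Set ℝ}
    (hγ : IsGeodesicOn I γ J) (hJ : J.OrdConnected) :
    ∃ a b : ℝ, ∀ t ∈ J, f (γ t) = a * t + b := by
  -- A one-point interval has no unique derivatives, but there any constant will do.
  rcases J.subsingleton_or_nontrivial with hs | hn
  · rcases hs.eq_empty_or_singleton with rfl | ⟨t, rfl⟩
    · exact ⟨0, 0, by simp⟩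
    · exact ⟨0, f (γ t), by simp⟩
  have hu := uniqueDiffOn_of_ordConnected_of_nontrivial hJ hn
  obtain ⟨t₀, ht₀⟩ := hn.nonempty
  set a : ℝ := d% f (γ t₀) (velocity I γ J t₀) with ha
  have hconst : ∀ t ∈ J, (d% f (γ t) (velocity I γ J t) : ℝ) = a := fun t ht ↦ by
    -- Mean value inequality with bound `0`, used again below for `f ∘ γ` minus its linear part.
    have := hJ.convex.norm_image_sub_le_of_norm_hasDerivWithin_le (C := 0)
      (fun s hs ↦ hγ.hasDerivWithinAt_mvfderiv_velocity hu f hs) (fun s _ ↦ by simp [hf]) ht₀ ht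
    rw [zero_mul, norm_le_zero_iff, sub_eq_zero] at this
    exact this
  refine ⟨a, f (γ t₀) - a * t₀, fun t ht ↦ ?_⟩
  have := hJ.convex.norm_image_sub_le_of_norm_hasDerivWithin_le (C := 0)
      (f := fun s ↦ f (γ s) - s * a) (f' := fun s ↦ d% f (γ s) (velocity I γ J s) - 1 * a)
      (fun s hs ↦ (hγ.hasDerivWithinAt_comp f hs).sub ((hasDerivWithinAt_id s J).mul_const a))
      (fun s hs ↦ by simp [hconst s hs]) ht₀ ht
  rw [zero_mul, norm_le_zero_iff, sub_eq_zero] at this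
  linarith

end GeodesicAffine

/-! ### Local existence of geodesics in the chart interior. -/

section GeodesicExistence

variable {E : Type*} [NormedAddCommGroup E] [NormedSpace ℝ E] [FiniteDimensional ℝ E]
  {H : Type*} [TopologicalSpace H] {I : ModelWithCorners ℝ E H}
  {M : Type*} [TopologicalSpace M] [ChartedSpace H M] [IsManifold I ∞ M]

theorem velocity_extChartAt_symm_comp (p : M) {x : ℝ → E} {v : E} {J : Set ℝ} {t : ℝ}
    (hJ : UniqueDiffWithinAt ℝ J t) (hx : ∀ s ∈ J, x s ∈ (extChartAt I p).target) (ht : t ∈ J)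
    (hv : HasDerivWithinAt x v J t) :
    velocity I (fun s ↦ (extChartAt I p).symm (x s)) J t =
      (trivializationAt E (TangentSpace I : M → Type _) p).symm ((extChartAt I p).symm (x t)) v := by
  rw [← mfderivWithin_extChartAt_symm_apply (hx t ht)]
  have h := mfderivWithin_comp (I := 𝓘(ℝ, ℝ)) (I' := 𝓘(ℝ, E)) (I'' := I) t
    (g := (extChartAt I p).symm) (f := x) (s := J) (u := Set.range I)
    (mdifferentiableWithinAt_extChartAt_symm (hx t ht))
    hv.differentiableWithinAt.mdifferentiableWithinAt
    (fun s hs ↦ extChartAt_target_subset_range p (hx s hs)) hJ.uniqueMDiffWithinAt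
  have h' := congr($h (1 : ℝ))
  refine h'.trans ?_
  rw [mfderivWithin_eq_fderivWithin]
  exact congrArg (mfderivWithin 𝓘(ℝ, E) I (extChartAt I p).symm (Set.range I) (x t))
    (hv.derivWithin hJ)

variable [RiemannianBundle (fun x : M ↦ TangentSpace I x)]
  [IsContMDiffRiemannianBundle I ∞ E (fun x : M ↦ TangentSpace I x)]

variable (I) in
/-- The acceleration `-Γ(z)(v, v)` of a geodesic with position `z` and velocity `v`, read in the
preferred chart at `p`. -/
def chartAcceleration (p : M) (z v : E) : E :=
  letI e := trivializationAt E (TangentSpace I : M → Type _) p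
  letI b := Module.finBasis ℝ E;
  -∑ i, b.repr v i • ∑ j, b.repr v j •
    (e ⟨(extChartAt I p).symm z, leviCivita I M (e.localFrame b i) ((extChartAt I p).symm z)
      (e.localFrame b j ((extChartAt I p).symm z))⟩).2

theorem contDiffAt_chartAcceleration (p : M) {z v : E} (hz : z ∈ interior (extChartAt I p).target) :
    ContDiffAt ℝ 1 (fun u : E × E ↦ chartAcceleration I p u.1 u.2) (z, v) := by
  set e := trivializationAt E (TangentSpace I : M → Type _) p with he
  let b := Module.finBasis ℝ E
  have hy : (extChartAt I p).symm z ∈ e.baseSet := by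
    rw [he, TangentBundle.trivializationAt_baseSet, ← extChartAt_source I]
    exact (extChartAt I p).map_target (interior_subset hz)
  have hs (i) : CMDiffAt 2 (T% (e.localFrame b i)) ((extChartAt I p).symm z) :=
    contMDiffAt_localFrame_of_mem 2 e b i hy
  have hφ : ContMDiffAt 𝓘(ℝ, E) I 1 (extChartAt I p).symm z :=
    (contMDiffOn_extChartAt_symm p).contMDiffAt (mem_interior_iff_mem_nhds.1 hz)
  have ha (i j) : ContDiffAt ℝ 1 (fun z ↦ (e ⟨(extChartAt I p).symm z,
      leviCivita I M (e.localFrame b i) ((extChartAt I p).symm z)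
        (e.localFrame b j ((extChartAt I p).symm z))⟩).2) z := by
    have h1 : ContMDiffAt _ _ _ _ _ := (e.contMDiffAt_section_iff hy).1 (contMDiffAt_leviCivita (hs j) (hs i))
    exact contMDiffAt_iff_contDiffAt.1 (h1.comp z hφ)
  have hc (i) : ContDiffAt ℝ 1 (fun u : E × E ↦ b.repr u.2 i) (z, v) :=
    (LinearMap.toContinuousLinearMap (b.coord i)).contDiff.contDiffAt.comp (z, v) contDiffAt_snd
  refine (ContDiffAt.sum fun i _ ↦ (hc i).smul (ContDiffAt.sum fun j _ ↦ (hc j).smul ?_)).neg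
  exact ContDiffAt.comp (f := Prod.fst) (z, v) (ha i j) contDiffAt_fst

/-- The sum over `j` reassembles the direction `∑ v^j e_j` by linearity of the connection in that
argument. -/
theorem symm_chartAcceleration (p : M) {z v : E} (hz : z ∈ (extChartAt I p).target) :
    letI e := trivializationAt E (TangentSpace I : M → Type _) p
    letI b := Module.finBasis ℝ E
    letI y := (extChartAt I p).symm z
    e.symm y (chartAcceleration I p z v) =
      -∑ i, b.repr v i • leviCivita I M (e.localFrame b i) y (e.symm y v) := by
  have hy : (extChartAt I p).symm z ∈ (trivializationAt E (TangentSpace I : M → Type _) p).baseSet := by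
    rw [TangentBundle.trivializationAt_baseSet, ← extChartAt_source I]
    exact (extChartAt I p).map_target hz
  set e := trivializationAt E (TangentSpace I : M → Type _) p
  rw [← e.symmL_apply (R := ℝ) hy, chartAcceleration, map_neg, map_sum]
  congr 1
  refine Finset.sum_congr rfl fun i _ ↦ ?_
  rw [map_smul, symm_eq_sum_localFrame (Module.finBasis ℝ E) hy v, map_sum, map_sum]
  congr 1
  refine Finset.sum_congr rfl fun j _ ↦ ?_
  rw [map_smul, map_smul, e.symmL_apply hy, e.symm_apply_apply_mk hy]

/-- Since `γ' = ∑ v^i e_i`, the acceleration is `∑ (v^i)' e_i + ∑ v^i ∇_{γ'} e_i`, and the equation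
for `v` says that the first sum cancels the second. -/
theorem isGeodesicOn_extChartAt_symm_comp (p : M) {x v : ℝ → E} {J : Set ℝ} (hJ : IsOpen J)
    (hxJ : ∀ t ∈ J, x t ∈ interior (extChartAt I p).target)
    (hx : ∀ t ∈ J, HasDerivAt x (v t) t)
    (hv : ∀ t ∈ J, HasDerivAt v (chartAcceleration I p (x t) (v t)) t) :
    IsGeodesicOn I (fun s ↦ (extChartAt I p).symm (x s)) J := by
  have hxt (t) (ht : t ∈ J) := interior_subset (hxJ t ht)
  -- Bootstrapping: the right-hand side of the ODE is continuous in time, so `v` is C^1 and `x` is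
  -- C^2.
  have hv1 : ContDiffOn ℝ 1 v J := by
    rw [show (1 : ℕ∞ω) = 0 + 1 by simp, contDiffOn_succ_iff_deriv_of_isOpen hJ]
    refine ⟨fun t ht ↦ (hv t ht).differentiableAt.differentiableWithinAt, by simp, ?_⟩
    rw [contDiffOn_zero]
    refine ContinuousOn.congr (f := fun t ↦ chartAcceleration I p (x t) (v t)) (fun t ht ↦ ?_)
      (fun t ht ↦ (hv t ht).deriv)
    exact ((contDiffAt_chartAcceleration p (hxJ t ht)).continuousAt.comp
      (f := fun t ↦ (x t, v t))
      ((hx t ht).continuousAt.prodMk (hv t ht).continuousAt)).continuousWithinAt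
  have hx2 : ContDiffOn ℝ 2 x J := by
    rw [show (2 : ℕ∞ω) = 1 + 1 by norm_num, contDiffOn_succ_iff_deriv_of_isOpen hJ]
    exact ⟨fun t ht ↦ (hx t ht).differentiableAt.differentiableWithinAt, by simp,
      hv1.congr fun t ht ↦ (hx t ht).deriv⟩
  have hγ : ContMDiffOn 𝓘(ℝ, ℝ) I 2 (fun s ↦ (extChartAt I p).symm (x s)) J :=
    (contMDiffOn_extChartAt_symm p).comp hx2.contMDiffOn hxt
  refine ⟨hγ, fun t ht ↦ ?_⟩
  set e := trivializationAt E (TangentSpace I : M → Type _) p with he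
  let b := Module.finBasis ℝ E
  have hmem (s) (hs : s ∈ J) : (extChartAt I p).symm (x s) ∈ e.baseSet := by
    rw [he, TangentBundle.trivializationAt_baseSet, ← extChartAt_source I]
    exact (extChartAt I p).map_target (hxt s hs)
  have hvel (s) (hs : s ∈ J) := velocity_extChartAt_symm_comp p (hJ.uniqueDiffWithinAt hs)
    hxt hs (hx s hs).hasDerivWithinAt
  rw [covDerivAlong_sum_smul (leviCivita I M) (hJ.uniqueDiffWithinAt ht) ht
    ((hγ t ht).mdifferentiableWithinAt (by simp)) (Y := e.localFrame b)
    (fun i ↦ (contMDiffAt_localFrame_of_mem 1 e b i (hmem t ht)).mdifferentiableAt (by simp))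
    (c := fun i s ↦ b.repr (v s) i)
    (fun i ↦ ((LinearMap.toContinuousLinearMap (b.coord i)).hasFDerivAt.comp_hasDerivAt t
      (hv t ht)).hasDerivWithinAt)
    (by
      filter_upwards [self_mem_nhdsWithin] with s hs
      rw [hvel s hs, symm_eq_sum_localFrame b (hmem s hs)])]
  rw [Finset.sum_add_distrib, hvel t ht]
  have h1 := symm_eq_sum_localFrame b (hmem t ht) (chartAcceleration I p (x t) (v t))
  rw [symm_chartAcceleration p (hxt t ht)] at h1
  refine (congrArg₂ (· + ·) h1.symm rfl).trans ?_
  exact neg_add_cancel _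

/-- Existence of geodesics with prescribed initial velocity at points in the interior of a chart. -/
theorem exists_isGeodesicOn (p : M) {z v : E} (hz : z ∈ interior (extChartAt I p).target) :
    ∃ ε > 0, ∃ γ : ℝ → M, IsGeodesicOn I γ (Set.Ioo (-ε) ε) ∧
      (⟨γ 0, velocity I γ (Set.Ioo (-ε) ε) 0⟩ : TangentBundle I M) =
        ⟨(extChartAt I p).symm z,
          (trivializationAt E (TangentSpace I : M → Type _) p).symm ((extChartAt I p).symm z) v⟩ := by
  -- Picard–Lindelöf for the autonomous system `(x, v)' = (v, chartAcceleration x v)`.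
  obtain ⟨α, hα0, ε, hε, hα⟩ :=
    (contDiffAt_snd.prodMk (contDiffAt_chartAcceleration (v := v) p hz)
     |>.exists_forall_mem_closedBall_exists_eq_forall_mem_Ioo_hasDerivAt₀ 0)
  have hcont : ContinuousAt α 0 := (hα 0 (by simpa using hε)).continuousAt
  have hev : ∀ᶠ t in nhds 0, (α t).1 ∈ interior (extChartAt I p).target :=
    (continuousAt_fst.comp hcont) (isOpen_interior.mem_nhds (by simpa [hα0] using hz))
  obtain ⟨δ, hδ, hδ'⟩ := Metric.eventually_nhds_iff.1 hev
  -- The time interval is shrunk so that the position stays in the chart interior.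
  set r := min ε δ with hr
  have hr0 : 0 < r := lt_min hε hδ
  have hαr (t) (ht : t ∈ Set.Ioo (-r) r) := hα t
    ⟨by linarith [ht.1, min_le_left ε δ], by linarith [ht.2, min_le_left ε δ]⟩
  have hint (t) (ht : t ∈ Set.Ioo (-r) r) : (α t).1 ∈ interior (extChartAt I p).target :=
    hδ' (by rw [dist_zero_right, Real.norm_eq_abs]; exact (abs_lt.2 ht).trans_le (min_le_right _ _))
  have h0 : (0 : ℝ) ∈ Set.Ioo (-r) r := by simpa using hr0
  have hx (t) (ht : t ∈ Set.Ioo (-r) r) : HasDerivAt (fun t ↦ (α t).1) (α t).2 t := (hαr t ht).fst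
  refine ⟨r, hr0, fun t ↦ (extChartAt I p).symm (α t).1,
    isGeodesicOn_extChartAt_symm_comp p isOpen_Ioo hint hx (fun t ht ↦ (hαr t ht).snd), ?_⟩
  rw [velocity_extChartAt_symm_comp p (isOpen_Ioo.uniqueDiffWithinAt h0)
    (fun t ht ↦ interior_subset (hint t ht)) h0 (hx 0 h0).hasDerivWithinAt]
  have h (u : E × E) (hu : u = (z, v)) :
      (⟨(extChartAt I p).symm u.1, (trivializationAt E (TangentSpace I : M → Type _) p).symm
        ((extChartAt I p).symm u.1) u.2⟩ : TangentBundle I M) = ⟨(extChartAt I p).symm z,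
          (trivializationAt E (TangentSpace I : M → Type _) p).symm
            ((extChartAt I p).symm z) v⟩ := by
    subst hu; rfl
  exact h _ hα0

end GeodesicExistence

/-! ### Affine along geodesics implies vanishing Hessian. -/

section HessianVanishing

variable {E : Type*} [NormedAddCommGroup E] [NormedSpace ℝ E] [FiniteDimensional ℝ E]
  {H : Type*} [TopologicalSpace H] {I : ModelWithCorners ℝ E H}
  {M : Type*} [TopologicalSpace M] [ChartedSpace H M] [IsManifold I ∞ M]

/-- The range of a model with corners lies in the closure of its interior, and near the point the
chart target fills that range. -/
theorem frequently_mem_interior_extChartAt_target (p : M) :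
    ∃ᶠ z in nhds (extChartAt I p p), z ∈ interior (extChartAt I p).target := by
  have h1 : ∃ᶠ z in nhds (extChartAt I p p), z ∈ interior (Set.range I) :=
    mem_closure_iff_frequently.1 (I.range_subset_closure_interior (Set.mem_range_self _))
  have h2 := (eventually_nhdsWithin_iff.1 (extChartAt_target_mem_nhdsWithin (I := I) p)).eventually_nhds
  refine (h1.and_eventually h2).mono fun z ⟨hz, hz'⟩ ↦ ?_
  rw [mem_interior_iff_mem_nhds] at hz ⊢
  filter_upwards [hz, hz'] with w hw hw' using hw' hw

variable [RiemannianBundle (fun x : M ↦ TangentSpace I x)]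
  [IsContMDiffRiemannianBundle I ∞ E (fun x : M ↦ TangentSpace I x)]

theorem continuousAt_hessian_leviCivita (f : C^∞⟮I, M; 𝓘(ℝ, ℝ), ℝ⟯) {x : M}
    {X Y : Π x : M, TangentSpace I x} (hX : CMDiffAt 2 (T% X) x) (hY : CMDiffAt 2 (T% Y) x) :
    ContinuousAt (fun y ↦ hessian (leviCivita I M) f y (X y) (Y y)) x := by
  have h2 : ((2 : ℕ∞) : ℕ∞ω) ≤ ∞ := by exact_mod_cast le_top
  have hf : CMDiffAt 2 f x := (f.contMDiff.of_le h2).contMDiffAt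
  have hYf : CMDiffAt 1 (fun y ↦ d% f y (Y y)) x :=
    contMDiffAt_mvfderiv_apply (m := 1) (n := 2) hf (hY.of_le (by norm_num)) (by norm_num)
  have h3 : CMDiffAt 0 (fun y ↦ d% (fun y ↦ d% f y (Y y)) y (X y)) x :=
    contMDiffAt_mvfderiv_apply (m := 0) (n := 1) hYf (hX.of_le (by norm_num)) (by norm_num)
  have h4 : CMDiffAt 1 (fun y ↦ d% f y (leviCivita I M Y y (X y))) x :=
    contMDiffAt_mvfderiv_apply (m := 1) (n := 2) hf (contMDiffAt_leviCivita hX hY) (by norm_num)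
  refine (h3.continuousAt.sub h4.continuousAt).congr ?_
  filter_upwards [(contMDiffAt_iff_contMDiffAt_nhds (by simp)).1 hX,
    (contMDiffAt_iff_contMDiffAt_nhds (by simp)).1 hY] with y hXy hYy
  exact (hessian_apply _ f (hXy.mdifferentiableAt (by simp)) (hYy.mdifferentiableAt (by simp))).symm

theorem IsGeodesicOn.hessian_velocity_eq_zero {f : C^∞⟮I, M; 𝓘(ℝ, ℝ), ℝ⟯} {γ : ℝ → M} {J : Set ℝ}
    (hγ : IsGeodesicOn I γ J) (hJ : UniqueDiffOn ℝ J) {a b : ℝ}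
    (hf : ∀ t ∈ J, f (γ t) = a * t + b) {t : ℝ} (ht : t ∈ J) :
    hessian (leviCivita I M) f (γ t) (velocity I γ J t) (velocity I γ J t) = 0 := by
  have h1 (s) (hs : s ∈ J) : (d% f (γ s) (velocity I γ J s) : ℝ) = a := by
    refine UniqueDiffWithinAt.eq_deriv J (hJ s hs) (hγ.hasDerivWithinAt_comp f hs) ?_
    refine HasDerivWithinAt.congr ?_ hf (hf s hs)
    simpa using ((hasDerivWithinAt_id s J).const_mul a).add_const b
  exact UniqueDiffWithinAt.eq_deriv J (hJ t ht) (hγ.hasDerivWithinAt_mvfderiv_velocity hJ f ht)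
    ((hasDerivWithinAt_const t J a).congr h1 (h1 t ht))

theorem hessian_eq_zero_of_mem_interior {f : C^∞⟮I, M; 𝓘(ℝ, ℝ), ℝ⟯}
    (hf : ∀ (J : Set ℝ) (γ : ℝ → M), J.OrdConnected → IsGeodesicOn I γ J →
      ∃ a b : ℝ, ∀ t ∈ J, f (γ t) = a * t + b) (p : M) {z : E}
    (hz : z ∈ interior (extChartAt I p).target) :
    hessian (leviCivita I M) f ((extChartAt I p).symm z) = 0 := by
  set q := (extChartAt I p).symm z with hq
  set e := trivializationAt E (TangentSpace I : M → Type _) p with he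
  have hqe : q ∈ e.baseSet := by
    rw [he, TangentBundle.trivializationAt_baseSet, ← extChartAt_source I]
    exact (extChartAt I p).map_target (interior_subset hz)
  have hdiag (w : TangentSpace I q) : hessian (leviCivita I M) f q w w = 0 := by
    obtain ⟨ε, hε, γ, hγ, hγ0⟩ := exists_isGeodesicOn (v := (e ⟨q, w⟩).2) p hz
    obtain ⟨a, b, hab⟩ := hf _ γ Set.ordConnected_Ioo hγ
    have h0 := hγ.hessian_velocity_eq_zero isOpen_Ioo.uniqueDiffOn hab (t := 0) (by simpa using hε)
    -- As a function on the total space, the quadratic form can be transported along `hγ0`, where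
    -- base point and vector change together.
    let Q (u : TangentBundle I M) : ℝ := hessian (leviCivita I M) f u.1 u.2 u.2
    have h1 := congrArg Q hγ0
    rw [← he, ← hq, e.symm_apply_apply_mk hqe] at h1
    exact h1.symm.trans h0
  ext v w
  -- Polarization of a symmetric form with zero diagonal.
  have h := hdiag (v + w)
  simp only [map_add, _root_.add_apply, hdiag, hessian_leviCivita_symm f w v] at h
  simp only [_root_.zero_apply]
  linarith

theorem hessian_eq_zero_of_affine {f : C^∞⟮I, M; 𝓘(ℝ, ℝ), ℝ⟯}
    (hf : ∀ (J : Set ℝ) (γ : ℝ → M), J.OrdConnected → IsGeodesicOn I γ J →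
      ∃ a b : ℝ, ∀ t ∈ J, f (γ t) = a * t + b) (p : M) :
    hessian (leviCivita I M) f p = 0 := by
  set e := trivializationAt E (TangentSpace I : M → Type _) p with he
  have hp : p ∈ e.baseSet := FiberBundle.mem_baseSet_trivializationAt' p
  let b := Module.finBasis ℝ E
  have hs (i) : CMDiffAt 2 (T% (e.localFrame b i)) p := contMDiffAt_localFrame_of_mem 2 e b i hp
  have hfreq : ∃ᶠ y in nhds p, hessian (leviCivita I M) f y = 0 := by
    have h1 := (frequently_mem_interior_extChartAt_target (I := I) p).mono fun z hz ↦
      hessian_eq_zero_of_mem_interior hf p hz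
    have h2 := (continuousAt_extChartAt_symm (I := I) p).tendsto.frequently
      (p := fun y ↦ hessian (leviCivita I M) f y = 0) h1
    rwa [extChartAt_to_inv] at h2
  -- A nonzero frame coefficient at `p` would, by continuity, stay nonzero on a neighbourhood, which
  -- contains points where the Hessian vanishes.
  have hij (i j) : hessian (leviCivita I M) f p (e.localFrame b i p) (e.localFrame b j p) = 0 := by
    by_contra hne
    obtain ⟨y, hy, hy'⟩ := (hfreq.and_eventually
      ((continuousAt_hessian_leviCivita f (hs i) (hs j)).eventually_ne hne)).exists
    exact hy' (by simp [hy])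
  apply ContinuousLinearMap.coe_injective
  refine (e.basisAt b hp).ext fun i ↦ ?_
  apply ContinuousLinearMap.coe_injective
  refine (e.basisAt b hp).ext fun j ↦ ?_
  simpa [e.localFrame_apply_of_mem_baseSet b hp] using hij i j

end HessianVanishing

end RiemannianHessian

end

theorem proposition1
    {E : Type*} [NormedAddCommGroup E] [NormedSpace ℝ E] [FiniteDimensional ℝ E]
    {H : Type*} [TopologicalSpace H] {I : ModelWithCorners ℝ E H}
    {M : Type*} [TopologicalSpace M] [ChartedSpace H M] [IsManifold I ∞ M]
    [RiemannianBundle (fun x : M ↦ TangentSpace I x)]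
    [IsContMDiffRiemannianBundle I ∞ E (fun x : M ↦ TangentSpace I x)]
    (f : C^∞⟮I, M; 𝓘(ℝ, ℝ), ℝ⟯) :
    (∀ p : M, RiemannianHessian.hessian (RiemannianHessian.leviCivita I M) f p = 0) ↔
      ∀ (J : Set ℝ) (γ : ℝ → M), J.OrdConnected → RiemannianHessian.IsGeodesicOn I γ J →
        ∃ a b : ℝ, ∀ t ∈ J, f (γ t) = a * t + b := by
  exact ⟨fun hf J γ hJ hγ ↦ hγ.exists_affine_of_hessian_eq_zero hf hJ,
    RiemannianHessian.hessian_eq_zero_of_affine⟩
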